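/- An infinite word is a sequence $w=w[0]w[1]w[2]\cdots$ of letters. The run-length encoding $\Delta(w)$ of an infinite word $w$ with infinitely many blocks (maximal runs of equal letters) is the infinite word whose $k$-th letter is the length of the $k$-th block of $w$. An infinite word $w$ over an alphabet $\mathcal A=\{a<b\}$ of two positive integers is smooth if, for every $k\ge 0$, the iterate $\Delta^k(w)$ is defined and is an infinite word over $\mathcal A$. An infinite word is a Lyndon word if it is strictly smaller, in the lexicographic order, than each of its proper suffixes (the words $w[k]w[k+1]w[k+2]\cdots$ with $k\ge 1$). Theorem. Let $n\ge 0$ be an integer and let $b=2(2n+1)$. Over the alphabet $\{1<b\}$, there is no infinite smooth word that is a Lyndon word. -/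

import Mathlib

namespace SmoothWords

/-- An infinite word, with letters in `ℕ`: the letter in position `i` is `w i`. -/
abbrev InfWord : Type := ℕ → ℕ

/-- The positions at which a block (maximal run of equal letters) of `w` starts. -/
def blockStarts (w : InfWord) : Set ℕ :=
  {i | i = 0 ∨ w i ≠ w (i - 1)}

/-- The position at which the block number `k` of `w` starts (blocks are numbered from `0`).
This is meaningful for every `k` when `w` has infinitely many blocks. -/
noncomputable def blockStart (w : InfWord) (k : ℕ) : ℕ :=
  Nat.nth (fun i => i ∈ blockStarts w) k

/-- The run-length encoding `Δ`: the letter number `k` of `Δ w` is the length of the block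
number `k` of `w`. The word `Δ w` is an infinite word over the positive integers exactly when `w`
has infinitely many blocks; only such `w` are encoded below. -/
noncomputable def runLength (w : InfWord) : InfWord :=
  fun k => blockStart w (k + 1) - blockStart w k

/-- `w` is an infinite smooth word over the alphabet `A`: for every `k`, the iterate `Δ^k w` is
defined, and is an infinite word over `A`. The iterate of order `k + 1` is defined as an infinite
word when `Δ^k w` has infinitely many blocks. -/
def IsSmooth (A : Set ℕ) (w : InfWord) : Prop :=
  ∀ k : ℕ, (∀ i : ℕ, (runLength^[k] w) i ∈ A) ∧ (blockStarts (runLength^[k] w)).Infinite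

/-- The strict lexicographic order on infinite words. -/
def LexLT (u v : InfWord) : Prop :=
  ∃ k : ℕ, (∀ i < k, u i = v i) ∧ u k < v k

/-- The suffix of `w` that starts in position `k`. -/
def suffix (w : InfWord) (k : ℕ) : InfWord :=
  fun i => w (k + i)

/-- `w` is an infinite Lyndon word: it is strictly smaller than each of its proper suffixes. -/
def IsLyndon (w : InfWord) : Prop :=
  ∀ k : ℕ, 0 < k → LexLT w (suffix w k)

end SmoothWords

namespace SmoothWords

/-! A word over two letters is recovered from its first letter and its run lengths. Hence the first
letters of `w`, `Δ w`, `Δ² w`, … determine longer and longer prefixes of a smooth word, and a finite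
case distinction on them can suffice.

In each case two occurrences of a finite word `Q` in some iterate are exhibited, one at the start
and one after a prefix `P`, followed by different letters. If `P` has even length, decoding yields
such a mismatch one level down (`Mismatch.of_runLength`): both copies start with the same letter,
and a block of length 1 against one of length `b` gives a new difference. Once the mismatch reaches
`w` with `b` at the start and `1` later, some suffix is not larger than `w`
(`IsLyndon.not_mismatch`).

For `b = 2` a bounded search finds the mismatches. For `b = 4m + 6` one explicit case tree serves
all `m`: words are written with powers whose exponents are linear in `m`, and decoding and prefix
tests are done symbolically. Decoding a power of a word of odd length needs the parity of the
exponent; `b` is even and `b / 2 = 2m + 3` is odd, which is enough for the mismatches in the tree.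
-/

/-- The letter of `{1, b}` encoded by a Boolean. -/
def letter (b : ℕ) (c : Bool) : ℕ := if c then b else 1

theorem exists_letter_eq {b x : ℕ} (h : x ∈ ({1, b} : Set ℕ)) : ∃ c, x = letter b c := by
  rcases h with h | h
  · exact ⟨false, h⟩
  · exact ⟨true, h⟩

/-! ### Blocks of an infinite word -/

theorem blockStart_zero (w : InfWord) : blockStart w 0 = 0 :=
  Nat.nth_zero_of_zero (Or.inl rfl)

theorem blockStart_strictMono {w : InfWord} (hw : (blockStarts w).Infinite) :
    StrictMono (blockStart w) :=
  Nat.nth_strictMono hw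

theorem blockStart_succ {w : InfWord} (hw : (blockStarts w).Infinite)
    (k : ℕ) : blockStart w (k + 1) = blockStart w k + runLength w k := by
  have := (blockStart_strictMono hw) (Nat.lt_add_one k)
  unfold runLength
  omega

theorem blockStart_ne {w : InfWord} (hw : (blockStarts w).Infinite)
    (k : ℕ) :
    w (blockStart w (k + 1)) ≠ w (blockStart w (k + 1) - 1) := by
  have h : blockStart w (k + 1) ∈ blockStarts w := Nat.nth_mem_of_infinite hw (k + 1)
  have := (blockStart_strictMono hw) (Nat.lt_add_one k)
  rcases h with h | h
  · omega
  · exact h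

theorem eq_blockStart_of_lt {w : InfWord} (hw : (blockStarts w).Infinite)
    (k i : ℕ) (hi : i < runLength w k) :
    w (blockStart w k + i) = w (blockStart w k) := by
  classical
  induction i with
  | zero => rfl
  | succ i ih =>
    rw [← ih (by omega)]
    by_contra hne
    have hmem : blockStart w k + (i + 1) ∈ blockStarts w := Or.inr hne
    -- A block start is the block whose number is the count of earlier starts; here that number
    -- would lie strictly between `k` and `k + 1`.
    have hc := Nat.nth_count (p := fun i => i ∈ blockStarts w) hmem
    change blockStart w _ = _ at hc
    have h1 := blockStart_succ hw k
    have h2 : k < Nat.count (fun i => i ∈ blockStarts w) (blockStart w k + (i + 1)) := by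
      rw [← (blockStart_strictMono hw).lt_iff_lt, hc]; omega
    have h3 : Nat.count (fun i => i ∈ blockStarts w) (blockStart w k + (i + 1)) < k + 1 := by
      rw [← (blockStart_strictMono hw).lt_iff_lt, hc]; omega
    omega

/-! ### Finite factors and decoding of run lengths -/

/-- The finite word `L` occurs in `w` in position `k`. -/
def OccursAt (b : ℕ) (w : InfWord) : ℕ → List Bool → Prop
  | _, [] => True
  | k, c :: l => w k = letter b c ∧ OccursAt b w (k + 1) l

theorem occursAt_append {b : ℕ} {w : InfWord} {k : ℕ} {l m : List Bool} :
    OccursAt b w k (l ++ m) ↔ OccursAt b w k l ∧ OccursAt b w (k + l.length) m := by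
  induction l generalizing k with
  | nil => simp [OccursAt]
  | cons c l ih =>
    simp only [List.cons_append, OccursAt, ih, List.length_cons, and_assoc]
    rw [show k + 1 + l.length = k + (l.length + 1) by omega]

theorem OccursAt.of_prefix {b : ℕ} {w : InfWord} {k : ℕ} {l m : List Bool}
    (h : OccursAt b w k m) (hl : l <+: m) : OccursAt b w k l := by
  obtain ⟨t, rfl⟩ := hl
  exact (occursAt_append.1 h).1

theorem occursAt_replicate {b : ℕ} {w : InfWord} {k n : ℕ} {c : Bool}
    (h : ∀ i < n, w (k + i) = letter b c) : OccursAt b w k (List.replicate n c) := by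
  induction n generalizing k with
  | zero => trivial
  | succ n ih =>
    refine ⟨h 0 (by omega), ih fun i hi => ?_⟩
    rw [← h (i + 1) (by omega)]
    congr 1; omega

theorem OccursAt.eq_letter {b : ℕ} {w : InfWord} {k : ℕ} {l : List Bool}
    (h : OccursAt b w k l) (i : ℕ) (hi : i < l.length) : w (k + i) = letter b l[i] := by
  induction l generalizing k i with
  | nil => simp at hi
  | cons c l ih =>
    cases i with
    | zero => exact h.1
    | succ i =>
      rw [show k + (i + 1) = k + 1 + i by omega]
      exact ih h.2 i (by simpa using hi)

/-- The finite word that starts with the letter `c` and has run lengths `L`. -/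
def decode (b : ℕ) : Bool → List Bool → List Bool
  | _, [] => []
  | c, x :: l => List.replicate (letter b x) c ++ decode b (!c) l

/-- The word `decode b c L`, followed by the first letter of the next block. -/
def decodeNext (b : ℕ) : Bool → List Bool → List Bool
  | c, [] => [c]
  | c, x :: l => List.replicate (letter b x) c ++ decodeNext b (!c) l

theorem decodeNext_append (b : ℕ) (c : Bool) (l m : List Bool) :
    decodeNext b c (l ++ m) = decode b c l ++ decodeNext b (c ^^ l.length.bodd) m := by
  induction l generalizing c with
  | nil => simp [decode]
  | cons x l ih => simp [decode, decodeNext, ih]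

theorem decode_append (b : ℕ) (c : Bool) (l m : List Bool) :
    decode b c (l ++ m) = decode b c l ++ decode b (c ^^ l.length.bodd) m := by
  induction l generalizing c with
  | nil => simp [decode]
  | cons x l ih => simp [decode, ih]

theorem decodeNext_eq (b : ℕ) (c : Bool) (l : List Bool) :
    decodeNext b c l = decode b c l ++ [c ^^ l.length.bodd] := by
  simpa [decodeNext] using decodeNext_append b c l []

theorem IsSmooth.infinite {A : Set ℕ} {w : InfWord} (h : IsSmooth A w) :
    (blockStarts w).Infinite := (h 0).2

theorem IsSmooth.mem {A : Set ℕ} {w : InfWord} (h : IsSmooth A w) (i : ℕ) : w i ∈ A := (h 0).1 i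

theorem IsSmooth.runLength {A : Set ℕ} {w : InfWord} (h : IsSmooth A w) :
    IsSmooth A (runLength w) := fun k => h (k + 1)

/-- The new block differs from the last letter of the previous one, and the alphabet has only two
letters. -/
theorem IsSmooth.letter_blockStart_succ {b : ℕ} {w : InfWord}
    (h : IsSmooth {1, b} w) {k : ℕ} {c : Bool} (hc : w (blockStart w k) = letter b c) :
    w (blockStart w (k + 1)) = letter b (!c) := by
  have h1 := blockStart_ne h.infinite k
  have h2 := blockStart_succ h.infinite k
  have h3 := (blockStart_strictMono h.infinite) (Nat.lt_add_one k)
  have h4 := eq_blockStart_of_lt h.infinite k (SmoothWords.runLength w k - 1) (by omega)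
  rw [show blockStart w k + (SmoothWords.runLength w k - 1) = blockStart w (k + 1) - 1 by omega,
    hc] at h4
  rw [h4] at h1
  obtain ⟨d, hd⟩ := exists_letter_eq (h.mem (blockStart w (k + 1)))
  rw [hd] at h1 ⊢
  have : d ≠ c := fun e => h1 (by rw [e])
  congr 1
  cases c <;> cases d <;> simp_all

theorem IsSmooth.occursAt_decodeNext {b : ℕ} {w : InfWord} (h : IsSmooth {1, b} w)
    {k : ℕ} {c : Bool} {l : List Bool} (hl : OccursAt b (SmoothWords.runLength w) k l)
    (hc : w (blockStart w k) = letter b c) :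
    OccursAt b w (blockStart w k) (decodeNext b c l) := by
  induction l generalizing k c with
  | nil => exact ⟨hc, trivial⟩
  | cons x l ih =>
    have h1 := blockStart_succ h.infinite k
    rw [hl.1] at h1
    refine occursAt_append.2 ⟨occursAt_replicate fun i hi => ?_, ?_⟩
    · rw [eq_blockStart_of_lt h.infinite k i (by rw [hl.1]; exact hi), hc]
    · rw [List.length_replicate, ← h1]
      exact ih hl.2 (h.letter_blockStart_succ hc)

theorem IsSmooth.occursAt_zero_decodeNext {b : ℕ} {w : InfWord} (h : IsSmooth {1, b} w)
    {c : Bool} {l : List Bool} (hl : OccursAt b (SmoothWords.runLength w) 0 l)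
    (hc : w 0 = letter b c) : OccursAt b w 0 (decodeNext b c l) := by
  have := h.occursAt_decodeNext (c := c) hl (by rwa [blockStart_zero])
  rwa [blockStart_zero] at this

/-! ### Mismatches and their transfer from `Δ w` to `w` -/

/-- The word `w` starts with `Q` followed by the letter `!s`, and has an occurrence of `Q` followed
by the letter `s` after a prefix `P`. -/
def Mismatch (b : ℕ) (w : InfWord) (P Q : List Bool) (s : Bool) : Prop :=
  OccursAt b w 0 (Q ++ [!s]) ∧ OccursAt b w 0 (P ++ (Q ++ [s]))

theorem replicate_letter_eq {b : ℕ} (hb : 2 ≤ b) (c : Bool) :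
    List.replicate (letter b true) c = [c, c] ++ List.replicate (b - 2) c := by
  obtain ⟨d, rfl⟩ := Nat.exists_eq_add_of_le hb
  simp [letter, Nat.add_comm 2 d, List.replicate_succ]

/-- As `P` has even length, both copies of `Q` decode to the same word. The blocks that follow begin
with the same letter `e`; the block of length `b` continues with `e`, the one of length 1 is
followed by the other letter. So `e` joins the common part and the difference moves one place on. -/
theorem Mismatch.of_runLength {b : ℕ} (hb : 2 ≤ b) {w : InfWord} (h : IsSmooth {1, b} w)
    {P Q : List Bool} {s c : Bool} (hm : Mismatch b (runLength w) P Q s)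
    (hP : P.length.bodd = false) (hc : w 0 = letter b c) :
    Mismatch b w (decode b c P) (decode b c Q ++ [c ^^ Q.length.bodd])
      ((c ^^ Q.length.bodd) ^^ !s) := by
  have h1 := h.occursAt_zero_decodeNext hm.1 hc
  have h2 := h.occursAt_zero_decodeNext hm.2 hc
  rw [decodeNext_append] at h1 h2
  rw [decodeNext_append, hP, Bool.xor_false] at h2
  generalize (c ^^ Q.length.bodd) = e at *
  cases s
  · constructor
    · refine h1.of_prefix ?_
      simp [decodeNext, replicate_letter_eq hb]
    · refine h2.of_prefix ?_
      simp [decodeNext, letter]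
  · constructor
    · refine h1.of_prefix ?_
      simp [decodeNext, letter]
    · refine h2.of_prefix ?_
      simp [decodeNext, replicate_letter_eq hb]

theorem IsLyndon.not_mismatch {b : ℕ} (hb : 2 ≤ b) {w : InfWord} (h : IsLyndon w)
    {P Q : List Bool} : ¬ Mismatch b w P Q false := by
  rintro ⟨h1, h2⟩
  have h2 := (occursAt_append.1 h2).2
  have a1 := fun i hi => h1.eq_letter i hi
  have a2 := fun i hi => h2.eq_letter i hi
  simp only [Nat.zero_add] at a1 a2
  have e1 : w Q.length = b := by simpa [letter] using a1 Q.length (by simp)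
  have e2 : w (P.length + Q.length) = 1 := by simpa [letter] using a2 Q.length (by simp)
  have hlt : ∀ i < Q.length, w i = w (P.length + i) := fun i hi => by
    rw [a1 i (by simp; omega), a2 i (by simp; omega)]
    simp [List.getElem_append_left hi]
  -- For empty `P` one position would carry both `b` and `1`. Otherwise the first difference from
  -- the suffix is at `Q.length`, where the suffix has the smaller letter.
  rcases Nat.eq_zero_or_pos P.length with h0 | h0
  · rw [h0, Nat.zero_add] at e2; omega
  · obtain ⟨k, hk, hk'⟩ := h _ h0
    simp only [suffix] at hk hk'
    rcases Nat.lt_trichotomy k Q.length with hq | hq | hq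
    · have := hlt k hq; omega
    · subst hq; omega
    · have := hk _ hq; omega

/-! ### Prefixes determined by the first letters of the iterates -/

/-- The first letters of `w`, `Δ w`, `Δ² w`, … are given by the list. -/
def HasHeads (b : ℕ) : InfWord → List Bool → Prop
  | _, [] => True
  | w, c :: p => w 0 = letter b c ∧ HasHeads b (runLength w) p

theorem HasHeads.extend {b : ℕ} {w : InfWord} {p : List Bool} (h : IsSmooth {1, b} w)
    (hp : HasHeads b w p) : ∃ c, HasHeads b w (p ++ [c]) := by
  induction p generalizing w with
  | nil =>
    obtain ⟨c, hc⟩ := exists_letter_eq (h.mem 0)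
    exact ⟨c, hc, trivial⟩
  | cons d p ih =>
    obtain ⟨c, hc⟩ := ih h.runLength hp.2
    exact ⟨c, hp.1, hc⟩

/-- The prefix of `w` that is determined by the first letters of `w`, `Δ w`, `Δ² w`, …. -/
def prefixOfHeads (b : ℕ) : List Bool → List Bool
  | [] => []
  | c :: p => decodeNext b c (prefixOfHeads b p)

theorem HasHeads.occursAt {b : ℕ} {w : InfWord} {p : List Bool} (h : IsSmooth {1, b} w)
    (hp : HasHeads b w p) : OccursAt b w 0 (prefixOfHeads b p) := by
  induction p generalizing w with
  | nil => trivial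
  | cons c p ih => exact h.occursAt_zero_decodeNext (ih h.runLength hp.2) hp.1

/-! ### The alphabet `{1, 2}`: bounded search -/

/-- At the first difference, `l` has the smaller letter. -/
def isSmaller : List Bool → List Bool → Bool
  | x :: l, y :: m => if x = y then isSmaller l m else !x
  | _, _ => false

theorem exists_of_isSmaller {l m : List Bool} (h : isSmaller l m = true) :
    ∃ Q, Q ++ [false] <+: l ∧ Q ++ [true] <+: m := by
  induction l generalizing m with
  | nil => simp [isSmaller] at h
  | cons x l ih =>
    cases m with
    | nil => simp [isSmaller] at h
    | cons y m =>
      by_cases hxy : x = y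
      · subst hxy
        obtain ⟨Q, h1, h2⟩ := ih (m := m) (by simpa [isSmaller] using h)
        exact ⟨x :: Q, by simpa using h1, by simpa using h2⟩
      · have : x = false := by simpa [isSmaller, hxy] using h
        subst this
        have : y = true := by simpa using hxy
        subst this
        exact ⟨[], by simp, by simp⟩

/-- Some nonempty suffix of the second word is smaller than the first word, at a position where
the two differ. -/
def hasSmallerSuffix (m : List Bool) : List Bool → Bool
  | [] => false
  | x :: l => isSmaller (x :: l) m || hasSmallerSuffix m l

theorem exists_of_hasSmallerSuffix {l m : List Bool} (h : hasSmallerSuffix m l = true) :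
    ∃ P Q, P ++ (Q ++ [false]) <+: l ∧ Q ++ [true] <+: m := by
  induction l with
  | nil => simp [hasSmallerSuffix] at h
  | cons x l ih =>
    simp only [hasSmallerSuffix, Bool.or_eq_true] at h
    rcases h with h | h
    · obtain ⟨Q, h⟩ := exists_of_isSmaller h
      exact ⟨[], Q, h⟩
    · obtain ⟨P, Q, h1, h2⟩ := ih h
      exact ⟨x :: P, Q, by simpa using h1, h2⟩

/-- Every extension of the list `p` of first letters leads, within the given depth, to a prefix with
a smaller suffix. -/
def refutable (b : ℕ) : ℕ → List Bool → Bool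
  | 0, _ => false
  | d + 1, p => hasSmallerSuffix (prefixOfHeads b p) (prefixOfHeads b p) ||
      (refutable b d (p ++ [false]) && refutable b d (p ++ [true]))

theorem not_hasHeads_of_refutable {b : ℕ} (hb : 2 ≤ b) {w : InfWord} (h : IsSmooth {1, b} w)
    (hl : IsLyndon w) {d : ℕ} {p : List Bool} (hd : refutable b d p = true) :
    ¬ HasHeads b w p := by
  induction d generalizing p with
  | zero => simp [refutable] at hd
  | succ d ih =>
    intro hp
    simp only [refutable, Bool.or_eq_true, Bool.and_eq_true] at hd
    rcases hd with hd | hd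
    · obtain ⟨P, Q, h1, h2⟩ := exists_of_hasSmallerSuffix hd
      exact hl.not_mismatch hb ⟨(hp.occursAt h).of_prefix h2, (hp.occursAt h).of_prefix h1⟩
    · obtain ⟨c, hc⟩ := hp.extend h
      cases c
      · exact ih hd.1 hc
      · exact ih hd.2 hc

theorem not_isLyndon_of_isSmooth_two {w : InfWord} (h : IsSmooth {1, 2} w) : ¬ IsLyndon w :=
  -- Depth 12 means lists of at most 11 first letters.
  fun hl => not_hasHeads_of_refutable (d := 12) (p := []) le_rfl h hl (by decide +kernel) trivial

/-! ### Powers of words and linear exponents -/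

/-- The word `u` repeated `k` times. -/
def repeated (k : ℕ) (u : List Bool) : List Bool := (List.replicate k u).flatten

theorem repeated_zero (u : List Bool) : repeated 0 u = [] := rfl

theorem repeated_one (u : List Bool) : repeated 1 u = u := by simp [repeated]

theorem repeated_add (k l : ℕ) (u : List Bool) :
    repeated (k + l) u = repeated k u ++ repeated l u := by
  simp only [repeated, List.replicate_add, List.flatten_append]

theorem repeated_succ (k : ℕ) (u : List Bool) : repeated (k + 1) u = u ++ repeated k u := by
  rw [Nat.add_comm, repeated_add, repeated_one]

theorem repeated_two_mul (k : ℕ) (u : List Bool) : repeated (2 * k) u = repeated k (u ++ u) := by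
  induction k with
  | zero => rfl
  | succ k ih =>
    rw [show 2 * (k + 1) = 2 * k + 1 + 1 by ring, repeated_succ, repeated_succ, repeated_succ, ih,
      List.append_assoc]

theorem repeated_append_comm (k : ℕ) (u v : List Bool) :
    u ++ repeated k (v ++ u) = repeated k (u ++ v) ++ u := by
  induction k with
  | zero => simp [repeated]
  | succ k ih => simp only [repeated_succ, List.append_assoc, ih]

theorem bodd_length_repeated (k : ℕ) (u : List Bool) :
    (repeated k u).length.bodd = (k.bodd && u.length.bodd) := by
  simp [repeated, Nat.bodd_mul]

theorem decode_repeated_of_even (b : ℕ) (c : Bool) (k : ℕ) {u : List Bool}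
    (hu : u.length.bodd = false) : decode b c (repeated k u) = repeated k (decode b c u) := by
  induction k with
  | zero => rfl
  | succ k ih => rw [repeated_succ, repeated_succ, decode_append, hu, Bool.xor_false, ih]

/-- After an odd number of blocks the starting letter is switched, so the copies of `u` decode
alternately in two ways and pairs of copies form the period. -/
theorem decode_repeated_two_mul (b : ℕ) (c : Bool) (k : ℕ) {u : List Bool}
    (hu : u.length.bodd = true) :
    decode b c (repeated (2 * k) u) = repeated k (decode b c u ++ decode b (!c) u) := by
  rw [repeated_two_mul, decode_repeated_of_even _ _ _ (by simp), decode_append, hu, Bool.xor_true]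

/-- The pair `(a, c)` stands for the exponent `a * m + c`. -/
def expVal (m : ℕ) (e : ℕ × ℕ) : ℕ := e.1 * m + e.2

/-- The parity of an exponent, when it does not depend on the parameter. -/
def expOdd (e : ℕ × ℕ) : Option Bool := if e.1 % 2 = 0 then some (e.2 % 2 == 1) else none

/-- Half of an exponent, rounded down. -/
def expHalf (e : ℕ × ℕ) : ℕ × ℕ := (e.1 / 2, e.2 / 2)

theorem expVal_eq_of_expOdd {m : ℕ} {e : ℕ × ℕ} {p : Bool} (h : expOdd e = some p) :
    expVal m e = 2 * expVal m (expHalf e) + (if p then 1 else 0) := by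
  obtain ⟨a, c⟩ := e
  simp only [expOdd, Option.ite_none_right_eq_some, Option.some.injEq] at h
  obtain ⟨h1, rfl⟩ := h
  obtain ⟨a, rfl⟩ := Nat.dvd_of_mod_eq_zero h1
  simp only [expVal, expHalf, Nat.mul_div_cancel_left a two_pos, beq_iff_eq]
  have := Nat.div_add_mod c 2
  split
  · next h => rw [h] at this; linarith
  · next h => rw [show c % 2 = 0 by omega] at this; linarith

theorem bodd_expVal {m : ℕ} {e : ℕ × ℕ} {p : Bool} (h : expOdd e = some p) :
    (expVal m e).bodd = p := by
  rw [expVal_eq_of_expOdd h]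
  cases p <;> simp [Nat.bodd_mul]

/-! ### Symbolic words and their decoding -/

/-- Finite words over `Bool`, with powers whose exponents are linear in a parameter. -/
inductive PowWord
  | nil
  | run (c : Bool) (e : ℕ × ℕ) (r : PowWord)
  | pow (u : PowWord) (e : ℕ × ℕ) (r : PowWord)
  deriving DecidableEq

namespace PowWord

/-- The word for a value of the parameter. -/
def eval (m : ℕ) : PowWord → List Bool
  | nil => []
  | run c e r => repeated (expVal m e) [c] ++ eval m r
  | pow u e r => repeated (expVal m e) (eval m u) ++ eval m r

/-- Concatenation. -/
def append : PowWord → PowWord → PowWord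
  | nil, v => v
  | run c e r, v => run c e (append r v)
  | pow u e r, v => pow u e (append r v)

theorem eval_append (m : ℕ) (u v : PowWord) : (u.append v).eval m = u.eval m ++ v.eval m := by
  induction u with
  | nil => rfl
  | run c e r ih => simp [append, eval, ih]
  | pow u e r _ ih => simp [append, eval, ih]

/-- The parity of the length, when it is found to be independent of the parameter. -/
def odd : PowWord → Option Bool
  | nil => some false
  | run _ e r =>
    match expOdd e, odd r with
    | some p, some q => some (p ^^ q)
    | _, _ => none
  | pow u e r =>
    match odd u with
    | none => none
    | some false => odd r
    | some true =>
      match expOdd e, odd r with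
      | some p, some q => some (p ^^ q)
      | _, _ => none

theorem bodd_length_eval {m : ℕ} {u : PowWord} {p : Bool} (h : u.odd = some p) :
    (u.eval m).length.bodd = p := by
  induction u generalizing p with
  | nil => simpa [odd, eval] using h
  | run c e r ih =>
    simp only [odd] at h
    split at h
    · next q q' h1 h2 =>
      cases h
      simp [eval, bodd_length_repeated, bodd_expVal h1, ih h2]
    · cases h
  | pow u e r ihu ih =>
    simp only [odd] at h
    split at h
    · cases h
    · next hu => simp [eval, bodd_length_repeated, ihu hu, ih h]
    · next hu =>
      split at h
      · next q q' h1 h2 =>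
        cases h
        simp [eval, bodd_length_repeated, bodd_expVal h1, ih h2, ihu hu]
      · cases h

/-- The exponent of a run of length `letter b x`, where `B` stands for `b`. -/
def letterExp (B : ℕ × ℕ) (x : Bool) : ℕ × ℕ := if x then B else (0, 1)

theorem expVal_letterExp (m : ℕ) (B : ℕ × ℕ) (x : Bool) :
    expVal m (letterExp B x) = letter (expVal m B) x := by
  cases x <;> simp [letterExp, letter, expVal]

/-- A prefix of the word that starts with `c` and has the given run lengths; the second component
tells whether this prefix is known to be the whole word. -/
def dec (B : ℕ × ℕ) : Bool → PowWord → PowWord × Bool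
  | _, nil => (nil, true)
  | c, run x e r =>
    if e = (0, 1) then
      (run c (letterExp B x) (dec B (!c) r).1, (dec B (!c) r).2)
    else match expOdd e with
    | none => (nil, false)
    | some false =>
      (pow (run c (letterExp B x) (run (!c) (letterExp B x) nil)) (expHalf e) (dec B c r).1,
        (dec B c r).2)
    | some true =>
      (run c (letterExp B x)
        (pow (run (!c) (letterExp B x) (run c (letterExp B x) nil)) (expHalf e) (dec B (!c) r).1),
        (dec B (!c) r).2)
  | c, pow u e r =>
    -- Something may follow the decoding of `u`, so a mere prefix of it is useless here.
    if (dec B c u).2 && (dec B (!c) u).2 then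
      match odd u with
      | none => (nil, false)
      | some false => (pow (dec B c u).1 e (dec B c r).1, (dec B c r).2)
      | some true =>
        match expOdd e with
        | none => (nil, false)
        | some false =>
          (pow ((dec B c u).1.append (dec B (!c) u).1) (expHalf e) (dec B c r).1, (dec B c r).2)
        | some true =>
          ((dec B c u).1.append
            (pow ((dec B (!c) u).1.append (dec B c u).1) (expHalf e) (dec B (!c) r).1),
            (dec B (!c) r).2)
    else (nil, false)

/-- The finite word `v` is a prefix of `l`, and is equal to `l` if the flag says so. -/
def Approximates (m : ℕ) (v : PowWord × Bool) (l : List Bool) : Prop :=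
  v.1.eval m <+: l ∧ (v.2 = true → v.1.eval m = l)

theorem approximates_nil (m : ℕ) (l : List Bool) : Approximates m (nil, false) l :=
  ⟨List.nil_prefix, by simp⟩

/-- An exactly decoded initial part `x` can be put in front without loss; this reduces each case of
`approximates_dec` to the remainder of the word. -/
theorem Approximates.append {m : ℕ} {v v' : PowWord × Bool} {l l' : List Bool}
    (h : Approximates m v l) (x : List Bool) (hv : v'.1.eval m = x ++ v.1.eval m)
    (hl : l' = x ++ l) (hs : v'.2 = v.2) : Approximates m v' l' := by
  subst hl
  refine ⟨?_, fun h2 => ?_⟩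
  · rw [hv]; exact (List.prefix_append_right_inj x).2 h.1
  · rw [hv, h.2 (hs ▸ h2)]

theorem decode_singleton (b : ℕ) (c x : Bool) :
    decode b c [x] = repeated (letter b x) [c] := by
  simp [decode, repeated]

/-- An odd power is split into one copy followed by an even power, which becomes a power of paired
copies. Where a needed parity or an exact decoding is missing, the empty prefix is a safe answer. -/
theorem approximates_dec (m : ℕ) (B : ℕ × ℕ) (c : Bool) (w : PowWord) :
    Approximates m (dec B c w) (decode (expVal m B) c (w.eval m)) := by
  induction w generalizing c with
  | nil => exact ⟨by simp [dec, eval, decode], by simp [dec, eval, decode]⟩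
  | run x e r ih =>
    have hx : [x].length.bodd = true := by simp
    simp only [dec, eval]
    split_ifs with he
    · refine (ih (!c)).append (repeated (letter (expVal m B) x) [c]) ?_ ?_ rfl
      · simp [eval, expVal_letterExp]
      · subst he
        simp [expVal, repeated, decode]
    · split
      · exact approximates_nil m _
      · next ho =>
        have hv := expVal_eq_of_expOdd (m := m) ho
        rw [if_neg Bool.false_ne_true, Nat.add_zero] at hv
        refine (ih c).append _ rfl ?_ rfl
        rw [decode_append, bodd_length_repeated, bodd_expVal ho, hv,
          decode_repeated_two_mul _ _ _ hx]
        simp [eval, expVal_letterExp, decode_singleton]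
      · next ho =>
        have hv := expVal_eq_of_expOdd (m := m) ho
        rw [if_pos rfl] at hv
        refine (ih (!c)).append (decode (expVal m B) c (repeated (expVal m e) [x])) ?_ ?_ rfl
        · rw [hv, repeated_succ, decode_append, hx, Bool.xor_true,
            decode_repeated_two_mul _ _ _ hx]
          simp [eval, expVal_letterExp, decode_singleton]
        · rw [decode_append, bodd_length_repeated, bodd_expVal ho, hx]
          simp
  | pow u e r ihu ih =>
    simp only [dec, eval]
    split_ifs with hd
    · rw [Bool.and_eq_true] at hd
      have d1 := (ihu c).2 hd.1
      have d2 := (ihu (!c)).2 hd.2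
      split
      · exact approximates_nil m _
      · next hu =>
        have hu := bodd_length_eval (m := m) hu
        refine (ih c).append _ rfl ?_ rfl
        rw [decode_append, bodd_length_repeated, hu, d1, decode_repeated_of_even _ _ _ hu]
        simp
      · next hu =>
        have hu := bodd_length_eval (m := m) hu
        split
        · exact approximates_nil m _
        · next ho =>
          have hv := expVal_eq_of_expOdd (m := m) ho
          rw [if_neg Bool.false_ne_true, Nat.add_zero] at hv
          refine (ih c).append _ rfl ?_ rfl
          rw [decode_append, bodd_length_repeated, bodd_expVal ho, hv,
            decode_repeated_two_mul _ _ _ hu, eval_append, d1, d2]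
          simp
        · next ho =>
          have hv := expVal_eq_of_expOdd (m := m) ho
          rw [if_pos rfl] at hv
          refine (ih (!c)).append
            (decode (expVal m B) c (repeated (expVal m e) (u.eval m))) ?_ ?_ rfl
          · rw [hv, repeated_succ, decode_append, hu, Bool.xor_true,
              decode_repeated_two_mul _ _ _ hu]
            simp [eval, eval_append, d1, d2]
          · rw [decode_append, bodd_length_repeated, bodd_expVal ho, hu]
            simp
    · exact approximates_nil m _

/-- A prefix of the word determined by a list of first letters. -/
def ofHeads (B : ℕ × ℕ) : List Bool → PowWord
  | [] => nil
  | c :: p =>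
    match (dec B c (ofHeads B p)).2, (ofHeads B p).odd with
    | true, some q => (dec B c (ofHeads B p)).1.append (run (c ^^ q) (0, 1) nil)
    | _, _ => (dec B c (ofHeads B p)).1

theorem occursAt_ofHeads {m : ℕ} {B : ℕ × ℕ} {w : InfWord} {p : List Bool}
    (h : IsSmooth {1, expVal m B} w) (hp : HasHeads (expVal m B) w p) :
    OccursAt (expVal m B) w 0 ((ofHeads B p).eval m) := by
  induction p generalizing w with
  | nil => trivial
  | cons c p ih =>
    refine (h.occursAt_zero_decodeNext (ih h.runLength hp.2) hp.1).of_prefix ?_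
    have ha := approximates_dec m B c (ofHeads B p)
    -- The letter of the next block may be appended only if the decoding is complete and the parity
    -- of the number of blocks is known.
    rw [decodeNext_eq]
    simp only [ofHeads]
    split
    · next q h1 h2 =>
      rw [eval_append, ha.2 h1, bodd_length_eval h2]
      simp [eval, expVal, repeated_one]
    · exact ha.1.trans (List.prefix_append _ _)

/-! ### Symbolic prefix test -/

/-- Rewrite `x(yx)ᵏ` as `(xy)ᵏx`, if this makes the word start with a power of `u`. -/
def rotate (u : PowWord) : PowWord → Option PowWord
  | run c e (pow (run y f (run c' e' nil)) k p) =>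
    if u = run c e (run y f nil) ∧ c' = c ∧ e' = e then some (pow u k (run c e p)) else none
  | _ => none

theorem eval_of_rotate {m : ℕ} {u v v' : PowWord} (h : rotate u v = some v') :
    v.eval m = v'.eval m := by
  unfold rotate at h
  split at h
  · next c e y f c' e' k p =>
    rw [Option.ite_none_right_eq_some] at h
    obtain ⟨⟨rfl, rfl, rfl⟩, h⟩ := h
    cases h
    have := repeated_append_comm (expVal m k) (repeated (expVal m e') [c'])
      (repeated (expVal m f) [y])
    simp only [eval, List.append_nil, ← List.append_assoc]
    rw [this]
  · cases h

/-- Difference of two exponents, if the coefficients do not become negative. -/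
def expSub (e f : ℕ × ℕ) : Option (ℕ × ℕ) :=
  if f.1 ≤ e.1 ∧ f.2 ≤ e.2 then some (e.1 - f.1, e.2 - f.2) else none

theorem expVal_of_expSub {m : ℕ} {e f g : ℕ × ℕ} (h : expSub e f = some g) :
    expVal m e = expVal m f + expVal m g := by
  rw [expSub, Option.ite_none_right_eq_some] at h
  obtain ⟨⟨h1, h2⟩, h⟩ := h
  cases h
  obtain ⟨a, ha⟩ := Nat.exists_eq_add_of_le h1
  obtain ⟨c, hc⟩ := Nat.exists_eq_add_of_le h2
  simp only [expVal, ha, hc, Nat.add_sub_cancel_left]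
  ring

/-- Remove the first copy of `u` from a power, or the whole power if its exponent is zero. -/
def unroll (u : PowWord) (e : ℕ × ℕ) (r : PowWord) : Option PowWord :=
  if e = (0, 0) then some r
  else (expSub e (0, 1)).map fun f => u.append (pow u f r)

theorem eval_of_unroll {m : ℕ} {u r v : PowWord} {e : ℕ × ℕ} (h : unroll u e r = some v) :
    (pow u e r).eval m = v.eval m := by
  unfold unroll at h
  split_ifs at h with he
  · cases h
    simp [eval, he, expVal, repeated_zero]
  · rw [Option.map_eq_some_iff] at h
    obtain ⟨f, h1, rfl⟩ := h
    rw [eval_append, eval, expVal_of_expSub h1, repeated_add]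
    simp [eval, expVal, repeated_one]

/-- Cancel equal powers of `u` at the beginning of two words. -/
def cancel (mk : ℕ × ℕ → PowWord → PowWord) (e e' : ℕ × ℕ) (p w : PowWord) :
    Option (PowWord × PowWord) :=
  match expSub e' e with
  | some f => some (p, mk f w)
  | none => (expSub e e').map fun f => (mk f p, w)

/-- The smaller exponent is removed on both sides. Exponents are compared coefficientwise, so the
same cancellation is valid for every `m`. -/
theorem prefix_of_cancel {m : ℕ} {mk : ℕ × ℕ → PowWord → PowWord} {l : List Bool}
    (hmk : ∀ e r, (mk e r).eval m = repeated (expVal m e) l ++ r.eval m)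
    {e e' : ℕ × ℕ} {p w : PowWord} {x : PowWord × PowWord} (h : cancel mk e e' p w = some x)
    (hx : x.1.eval m <+: x.2.eval m) : (mk e p).eval m <+: (mk e' w).eval m := by
  unfold cancel at h
  split at h
  · next f hf =>
    cases h
    rw [hmk] at *
    rw [hmk, expVal_of_expSub hf, repeated_add, List.append_assoc]
    exact (List.prefix_append_right_inj _).2 hx
  · rw [Option.map_eq_some_iff] at h
    obtain ⟨f, hf, rfl⟩ := h
    rw [hmk] at *
    rw [hmk, expVal_of_expSub hf, repeated_add, List.append_assoc]
    exact (List.prefix_append_right_inj _).2 hx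

/-- One step of the comparison of two words. -/
def step : PowWord → PowWord → Option (PowWord × PowWord)
  | nil, _ => none
  | _, nil => none
  | run c e p, run c' e' w =>
    if e = (0, 0) then some (p, run c' e' w)
    else if e' = (0, 0) then some (run c e p, w)
    else if c = c' then cancel (run c) e e' p w else none
  | run c e p, pow u k w =>
    if e = (0, 0) then some (p, pow u k w)
    else match rotate u (run c e p) with
    | some v => some (v, pow u k w)
    | none => (unroll u k w).map fun v => (run c e p, v)
  | pow u k p, run c e w =>
    if e = (0, 0) then some (pow u k p, w)
    else (unroll u k p).map fun v => (v, run c e w)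
  | pow u k p, pow u' k' w =>
    if u = u' then cancel (pow u) k k' p w
    else (unroll u' k' w).map fun v => (pow u k p, v)

theorem prefix_of_step {m : ℕ} {p w : PowWord} {x : PowWord × PowWord} (h : step p w = some x)
    (hx : x.1.eval m <+: x.2.eval m) : p.eval m <+: w.eval m := by
  unfold step at h
  split at h
  · cases h
  · cases h
  · split_ifs at h with h1 h2 h3
    · cases h
      simpa [eval, h1, expVal, repeated_zero] using hx
    · cases h
      simpa [eval, h2, expVal, repeated_zero] using hx
    · subst h3
      exact prefix_of_cancel (fun _ _ => rfl) h hx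
  · split_ifs at h with h1
    · cases h
      simpa [eval, h1, expVal, repeated_zero] using hx
    · split at h
      · next hr =>
        cases h
        rwa [eval_of_rotate hr]
      · rw [Option.map_eq_some_iff] at h
        obtain ⟨v, hv, rfl⟩ := h
        rwa [eval_of_unroll hv]
  · split_ifs at h with h1
    · cases h
      simpa [eval, h1, expVal, repeated_zero] using hx
    · rw [Option.map_eq_some_iff] at h
      obtain ⟨v, hv, rfl⟩ := h
      rwa [eval_of_unroll hv]
  · split_ifs at h with h1
    · subst h1
      exact prefix_of_cancel (fun _ _ => rfl) h hx
    · rw [Option.map_eq_some_iff] at h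
      obtain ⟨v, hv, rfl⟩ := h
      rwa [eval_of_unroll hv]

/-- Test whether the first word is a prefix of the second one for all values of the parameter. -/
def isPrefix : ℕ → PowWord → PowWord → Bool
  | 0, _, _ => false
  | n + 1, p, w =>
    match p with
    | nil => true
    | p =>
      match step p w with
      | none => false
      | some x => isPrefix n x.1 x.2

/-- Only soundness is needed: a negative answer, by lack of a step or of fuel, asserts nothing. -/
theorem prefix_of_isPrefix (m : ℕ) {n : ℕ} {p w : PowWord} (h : isPrefix n p w = true) :
    p.eval m <+: w.eval m := by
  induction n generalizing p w with
  | zero => simp [isPrefix] at h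
  | succ n ih =>
    simp only [isPrefix] at h
    split at h
    · exact List.nil_prefix
    · split at h
      · cases h
      · next hs => exact prefix_of_step hs (ih h)

/-! ### Symbolic mismatches and the case tree -/

/-- The mismatch `(P, Q, s)` of `Δᴷ w`, checked and transferred to `w`, where `p` lists the first
letters of `w`, `Δ w`, …. -/
def transfer (B : ℕ × ℕ) (P Q : PowWord) (s : Bool) :
    ℕ → List Bool → Option (PowWord × PowWord × Bool)
  | 0, p =>
    if isPrefix 200 (Q.append (run (!s) (0, 1) nil)) (ofHeads B p) &&
        isPrefix 200 (P.append (Q.append (run s (0, 1) nil))) (ofHeads B p) then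
      some (P, Q, s)
    else none
  | _ + 1, [] => none
  | K + 1, c :: p =>
    match transfer B P Q s K p with
    | none => none
    | some (P, Q, s) =>
      match odd P, odd Q with
      | some false, some q =>
        if (dec B c P).2 && (dec B c Q).2 then
          some ((dec B c P).1, (dec B c Q).1.append (run (c ^^ q) (0, 1) nil), (c ^^ q) ^^ !s)
        else none
      | _, _ => none

theorem eval_singleton (m : ℕ) (c : Bool) : (run c (0, 1) nil).eval m = [c] := by
  simp [eval, expVal, repeated_one]

/-- At level `K` the mismatch is read off the prefix forced by the remaining first letters; each
step back to `w` is `Mismatch.of_runLength`, with decodings known to be exact. -/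
theorem mismatch_of_transfer {m : ℕ} {B : ℕ × ℕ} (hb : 2 ≤ expVal m B) {P Q : PowWord} {s : Bool}
    {K : ℕ} {p : List Bool} {w : InfWord} (h : IsSmooth {1, expVal m B} w)
    (hp : HasHeads (expVal m B) w p) {x : PowWord × PowWord × Bool}
    (hx : transfer B P Q s K p = some x) :
    Mismatch (expVal m B) w (x.1.eval m) (x.2.1.eval m) x.2.2 := by
  induction K generalizing w p x with
  | zero =>
    simp only [transfer, Option.ite_none_right_eq_some, Bool.and_eq_true] at hx
    obtain ⟨⟨h1, h2⟩, hx⟩ := hx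
    cases hx
    have h1 := prefix_of_isPrefix m h1
    have h2 := prefix_of_isPrefix m h2
    have ho := occursAt_ofHeads h hp
    simp only [eval_append, eval_singleton] at h1 h2
    exact ⟨ho.of_prefix h1, ho.of_prefix h2⟩
  | succ K ih =>
    cases p with
    | nil => simp [transfer] at hx
    | cons c p =>
      simp only [transfer] at hx
      split at hx
      · cases hx
      · next P' Q' s' ht =>
        have hm := ih h.runLength hp.2 ht
        split at hx
        · next q hP hQ =>
          rw [Option.ite_none_right_eq_some, Bool.and_eq_true] at hx
          obtain ⟨⟨h1, h2⟩, hx⟩ := hx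
          cases hx
          have := hm.of_runLength hb h (bodd_length_eval hP) hp.1
          simp only [eval_append, eval_singleton, (approximates_dec m B c _).2 h1,
            (approximates_dec m B c _).2 h2]
          rwa [bodd_length_eval hQ] at this
        · cases hx

/-- A case distinction on the first letters of `w`, `Δ w`, `Δ² w`, …, with a mismatch in some
iterate `Δᴷ w` in every case. -/
inductive Refutation
  | mismatch (K : ℕ) (P Q : PowWord) (s : Bool)
  | split (l r : Refutation)

/-- Check a refutation of the existence of a Lyndon word with given first letters. -/
def Refutation.check (B : ℕ × ℕ) : Refutation → List Bool → Bool
  | mismatch K P Q s, p =>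
    match transfer B P Q s K p with
    | some (_, _, false) => true
    | _ => false
  | split l r, p => l.check B (p ++ [false]) && r.check B (p ++ [true])

/-- Every branch ends in a mismatch of `w` with sign `false`, the one excluded for Lyndon words. -/
theorem Refutation.not_hasHeads {m : ℕ} {B : ℕ × ℕ} (hb : 2 ≤ expVal m B) {w : InfWord}
    (h : IsSmooth {1, expVal m B} w) (hl : IsLyndon w) {t : Refutation} {p : List Bool}
    (ht : t.check B p = true) : ¬ HasHeads (expVal m B) w p := by
  induction t generalizing p with
  | mismatch K P Q s =>
    intro hp
    simp only [check] at ht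
    split at ht
    · next hx => exact hl.not_mismatch hb (mismatch_of_transfer hb h hp hx)
    · cases ht
  | split l r ihl ihr =>
    intro hp
    simp only [check, Bool.and_eq_true] at ht
    obtain ⟨c, hc⟩ := hp.extend h
    cases c
    · exact ihl ht.1 hc
    · exact ihr ht.2 hc

/-- A refutation for the alphabet `{1, 4 * m + 6}`. -/
def refutation : Refutation :=
  (.split
    (.split
      (.split
        (.split
          (.mismatch 1 (run false (0, 1) <| run true (0, 1) nil) nil true)
          (.mismatch 2 (run false (4, 6) nil) nil true))
        (.mismatch 1 (run false (4, 6) nil) nil true))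
      (.split
        (.split
          (.split
            (.mismatch 1 (run true (0, 1) <| pow (run false (4, 6) <| run true (4, 6) nil) (2, 2)
              <| run false (4, 6) <| run true (4, 5) nil) (run true (0, 1) <| run false (0, 1)
              nil) true)
            (.split
              (.mismatch 1 (pow (run true (0, 1) <| run false (4, 6) nil) (2, 3) <| pow (run true
                (0, 1) <| run false (0, 1) nil) (2, 3) <| run true (4, 5) nil) (run true (0, 1) <|
                run false (0, 1) nil) true)
              (.mismatch 3 (pow (run false (4, 6) <| run true (4, 6) nil) (0, 1) <| run false
                (4, 6) nil) nil true)))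
          (.split
            (.split
              (.split
                (.mismatch 3 (run true (0, 1) <| pow (run false (4, 6) <| run true (4, 6) nil)
                  (2, 1) <| run false (4, 6) <| run true (4, 5) nil) (run true (0, 1) <| pow (run
                  false (4, 6) <| run true (4, 6) nil) (0, 1) <| run false (0, 1) nil) true)
                (.split
                  (.split
                    (.mismatch 3 (pow (run true (0, 1) <| run false (4, 6) nil) (2, 3) <| pow (run
                      true (0, 1) <| run false (0, 1) nil) (2, 3) <| run true (4, 6) <| pow (pow
                      (run false (0, 1) <| run true (0, 1) nil) (2, 3) <| run false (4, 6) <| pow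
                      (run true (0, 1) <| run false (0, 1) nil) (2, 3) <| run true (4, 6) nil)
                      (1, 1) <| pow (run false (0, 1) <| run true (0, 1) nil) (2, 3) <| pow (run
                      false (4, 6) <| run true (4, 6) nil) (2, 1) <| run false (4, 6) <| run true
                      (4, 3) nil) (run true (0, 1) nil) true)
                    (.mismatch 4 (pow (run false (0, 1) <| run true (0, 1) nil) (2, 3) <| run
                      false (4, 6) <| pow (run true (0, 1) <| run false (0, 1) nil) (0, 1) nil)
                      nil true))
                  (.mismatch 4 (pow (pow (run false (0, 1) <| run true (0, 1) nil) (2, 3) <| pow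
                    (run false (4, 6) <| run true (4, 6) nil) (2, 3) nil) (0, 1) <| pow (run false
                    (0, 1) <| run true (0, 1) nil) (2, 3) <| run false (4, 6) nil) nil true)))
              (.split
                (.split
                  (.mismatch 1 (pow (run true (0, 1) <| run false (0, 1) nil) (2, 3) <| run true
                    (4, 6) <| pow (pow (run false (0, 1) <| run true (0, 1) nil) (2, 3) <| run
                    false (4, 6) <| pow (run true (0, 1) <| run false (0, 1) nil) (2, 3) <| run
                    true (4, 6) nil) (1, 1) <| pow (pow (run false (0, 1) <| run true (0, 1) nil)
                    (2, 3) <| pow (run false (4, 6) <| run true (4, 6) nil) (2, 3) nil) (2, 3) <|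
                    run false (0, 1) <| pow (pow (run true (4, 6) <| run false (4, 6) nil) (2, 3)
                    <| pow (run true (0, 1) <| run false (0, 1) nil) (2, 3) nil) (2, 3) <| run
                    true (4, 5) nil) (run true (0, 1) <| pow (run false (0, 1) <| run true (0, 1)
                    nil) (2, 2) <| run false (0, 1) <| run true (0, 1) nil) false)
                  (.mismatch 6 (run false (4, 4) nil) (run false (0, 2) nil) true))
                (.mismatch 5 (run true (4, 4) nil) (run true (0, 2) nil) false)))
            (.split
              (.split
                (.split
                  (.mismatch 1 (pow (pow (run true (0, 1) <| run false (0, 1) nil) (2, 3) <| pow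
                    (run true (4, 6) <| run false (4, 6) nil) (2, 3) nil) (2, 3) <| run true
                    (0, 1) <| pow (run false (4, 6) <| run true (4, 6) nil) (2, 3) <| pow (run
                    false (0, 1) <| pow (run true (4, 6) <| run false (4, 6) nil) (2, 3) <| run
                    true (0, 1) <| pow (run false (4, 6) <| run true (4, 6) nil) (2, 3) nil)
                    (1, 1) <| pow (pow (run false (0, 1) <| run true (4, 6) nil) (2, 3) <| pow
                    (pow (run false (0, 1) <| run true (0, 1) nil) (2, 3) <| pow (run false (4, 6)
                    <| run true (4, 6) nil) (2, 3) nil) (2, 3) nil) (2, 1) <| pow (run false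
                    (0, 1) <| run true (4, 6) nil) (2, 2) <| run false (0, 1) <| run true (4, 5)
                    nil) (run true (0, 1) <| pow (run false (0, 1) <| run true (0, 1) nil) (2, 2)
                    <| run false (0, 1) <| run true (0, 1) nil) false)
                  (.mismatch 1 (pow (pow (run true (0, 1) <| run false (0, 1) nil) (2, 3) <| pow
                    (run true (4, 6) <| run false (4, 6) nil) (2, 3) nil) (2, 3) <| run true
                    (0, 1) <| pow (run false (4, 6) <| run true (4, 6) nil) (2, 3) <| pow (run
                    false (0, 1) <| pow (run true (4, 6) <| run false (4, 6) nil) (2, 3) <| run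
                    true (0, 1) <| pow (run false (4, 6) <| run true (4, 6) nil) (2, 3) nil)
                    (1, 1) <| pow (pow (run false (0, 1) <| run true (4, 6) nil) (2, 3) <| pow
                    (run false (0, 1) <| run true (0, 1) nil) (2, 3) <| run false (4, 6) <| pow
                    (pow (run true (0, 1) <| run false (0, 1) nil) (2, 3) <| run true (4, 6) <|
                    pow (run false (0, 1) <| run true (0, 1) nil) (2, 3) <| run false (4, 6) nil)
                    (1, 1) <| pow (pow (run true (0, 1) <| run false (0, 1) nil) (2, 3) <| pow
                    (run true (4, 6) <| run false (4, 6) nil) (2, 3) nil) (2, 3) <| run true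
                    (0, 1) <| pow (run false (4, 6) <| run true (4, 6) nil) (2, 3) <| pow (run
                    false (0, 1) <| pow (run true (4, 6) <| run false (4, 6) nil) (2, 3) <| run
                    true (0, 1) <| pow (run false (4, 6) <| run true (4, 6) nil) (2, 3) nil)
                    (1, 1) nil) (1, 1) <| pow (run false (0, 1) <| run true (4, 6) nil) (2, 3) <|
                    pow (run false (0, 1) <| run true (0, 1) nil) (2, 3) <| pow (pow (run false
                    (4, 6) <| run true (0, 1) nil) (2, 3) <| pow (run false (4, 6) <| run true
                    (4, 6) nil) (2, 3) <| pow (run false (0, 1) <| run true (4, 6) nil) (2, 3) <|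
                    pow (run false (0, 1) <| run true (0, 1) nil) (2, 3) nil) (1, 1) <| pow (run
                    false (4, 6) <| run true (0, 1) nil) (2, 3) <| pow (run false (4, 6) <| run
                    true (4, 6) nil) (2, 2) <| run false (4, 6) <| run true (4, 5) nil) (pow (run
                    true (0, 1) <| run false (0, 1) nil) (2, 3) <| run true (0, 1) nil) false))
                (.mismatch 1 (pow (pow (run true (0, 1) <| run false (0, 1) nil) (2, 3) <| pow
                  (run true (4, 6) <| run false (4, 6) nil) (2, 3) nil) (2, 3) <| run true (0, 1)
                  <| pow (run false (4, 6) <| run true (4, 6) nil) (2, 2) <| run false (4, 6) <|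
                  run true (4, 5) nil) (pow (run true (0, 1) <| run false (0, 1) nil) (2, 3) <|
                  run true (0, 1) nil) false))
              (.mismatch 4 (run true (4, 4) nil) (run true (0, 2) nil) false))))
        (.split
          (.split
            (.split
              (.mismatch 2 (run true (0, 1) <| pow (run false (4, 6) <| run true (4, 6) nil)
                (2, 2) <| run false (4, 6) <| run true (4, 5) nil) (run true (0, 1) <| run false
                (0, 1) nil) true)
              (.mismatch 2 (pow (run true (0, 1) <| run false (4, 6) nil) (0, 1) <| run true
                (0, 1) nil) nil false))
            (.mismatch 1 (pow (run true (4, 6) <| run false (0, 1) nil) (2, 3) <| run true (4, 5)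
              nil) (run true (0, 1) nil) false))
          (.mismatch 2 (run true (4, 6) nil) nil false))))
    (.split
      (.mismatch 0 (run true (0, 1) nil) nil false)
      (.mismatch 0 (run true (4, 6) nil) nil false)))

-- The pair `(4, 6)` stands for `b = 4m + 6`; a single evaluation covers all `m`.
theorem check_refutation : refutation.check (4, 6) [] = true := by decide +kernel

end PowWord

/-! ### Conclusion -/

theorem not_isLyndon_of_isSmooth {m : ℕ} {w : InfWord} (h : IsSmooth {1, 4 * m + 6} w) :
    ¬ IsLyndon w :=
  fun hl => PowWord.Refutation.not_hasHeads (m := m) (B := (4, 6)) (by simp [expVal])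
    h hl PowWord.check_refutation trivial

end SmoothWords

theorem theorem34 (n b : ℕ) (hb : b = 2 * (2 * n + 1)) :
    ¬ ∃ w : SmoothWords.InfWord,
      SmoothWords.IsSmooth ({1, b} : Set ℕ) w ∧ SmoothWords.IsLyndon w := by
  rintro ⟨w, h, hl⟩
  -- The exponents in the tree require `b ≥ 6`, so `b = 2` is separate; for `n = m + 1` one has `b =
  -- 4m + 6`.
  cases n with
  | zero =>
    subst hb
    exact SmoothWords.not_isLyndon_of_isSmooth_two h hl
  | succ m =>
    rw [show b = 4 * m + 6 by omega] at h
    exact SmoothWords.not_isLyndon_of_isSmooth h hl
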